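/- **Theorem 1.1.** Let $P_L(a,z)\in\mathbb Z[a^{\pm1},z^{\pm1}]$ be the Jones–Conway (Homfly) polynomial, i.e. the invariant of oriented links $L$ up to isotopy described by (i) $P_{T_1}(a,z)=1$ for the trivial knot $T_1$ and (ii) $a\,P_{L_+}(a,z)+a^{-1}P_{L_-}(a,z)=z\,P_{L_0}(a,z)$ whenever $L_+,L_-,L_0$ have diagrams that are identical except at one place, where $L_+$ has a positive crossing, $L_-$ a negative crossing, and $L_0$ the smoothed crossing. Let $L$ be an oriented link diagram with a marked place at which two neighbouring strands run parallel in the same direction, and for each integer $k\ge 0$ let $t_k(L)$ be the diagram obtained from $L$ by inserting $k$ positive half twists (that is, $k$ consecutive positive crossings of these two strands) at the marked place. Define integer polynomials $v_1^{(k)}(z)$, $k\ge -1$, by $$v_1^{(-1)}(z)=-1,\qquad v_1^{(0)}(z)=0,\qquad v_1^{(1)}(z)=1,\qquad v_1^{(k+2)}(z)=z\,v_1^{(k+1)}(z)-v_1^{(k)}(z)\quad(k\ge -1).$$ Then for every $k\ge 0$ $$a^kP_{t_k(L)}(a,z)=a\,v_1^{(k)}(z)\,P_{t_1(L)}(a,z)-v_1^{(k-1)}(z)\,P_L(a,z).$$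 In particular, if one substitutes $z=p+p^{-1}$ (with $p$ in any field, $p\neq0$, $p^2\neq1$), one gets, for every $k\ge -1$, $$v_1^{(k)}(p+p^{-1})=\frac{p^k-p^{-k}}{p-p^{-1}}.$$ -/

import Mathlib

namespace TkMoves

/-! Oriented link diagrams are recorded in Morse position: the diagram is read from bottom to top as
a sequence of elementary pieces, each consisting of one minimum (`cup`), one maximum (`cap`) or one
crossing, with vertical strands to the left and to the right of it. Strands at a given height are
numbered from left to right, starting with `0`. The direction of a strand at a given height is
`true` if it points upwards and `false` if it points downwards. -/

/-- The kinds of elementary pieces.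
* `cup b`: a local minimum; it creates two new neighbouring strands, the left one with direction
  `b` and the right one with direction `!b`.
* `cap`: a local maximum; it joins two neighbouring strands of opposite directions.
* `cross ε`: two neighbouring strands cross. If `ε = true`, the strand running from bottom left to
  top right is the overcrossing one; if `ε = false`, it is the undercrossing one. -/
inductive Kind : Type
  | cup (b : Bool)
  | cap
  | cross (ε : Bool)

/-- Number of strands entering a piece from below. -/
def Kind.inputs : Kind → ℕ
  | .cup _ => 0
  | .cap => 2
  | .cross _ => 2

/-- Number of strands leaving a piece at its top. -/
def Kind.outputs : Kind → ℕ
  | .cup _ => 2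
  | .cap => 0
  | .cross _ => 2

/-- An elementary piece placed so that exactly `pos` vertical strands are on its left. -/
structure Piece : Type where
  pos : ℕ
  kind : Kind

/-- The effect of a piece of kind `k` on the list of directions of the strands that are not to the
left of it; `none` if the piece does not fit. -/
def Kind.act : Kind → List Bool → Option (List Bool)
  | .cup b, s => some (b :: (!b) :: s)
  | .cap, x :: y :: s => if y = !x then some s else none
  | .cross _, x :: y :: s => some (y :: x :: s)
  | _, _ => none

/-- The list of strand directions above a piece, given the list of strand directions below it;
`none` if the piece does not fit. -/
def Piece.act (p : Piece) (s : List Bool) : Option (List Bool) :=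
  if p.pos ≤ s.length then (p.kind.act (s.drop p.pos)).map (s.take p.pos ++ ·) else none

/-- The list of strand directions above a stack of pieces (listed from bottom to top), given the
list of strand directions below it; `none` if the pieces do not fit together. -/
def run : List Piece → List Bool → Option (List Bool)
  | [], s => some s
  | p :: w, s => (p.act s).bind (run w)

/-- An oriented link diagram in Morse position (of a link with at least one component). -/
structure LinkDiagram : Type where
  word : List Piece
  closed : run word [] = some []
  nonempty : word ≠ []

/-- The local moves: planar isotopies of diagrams in Morse position and Reidemeister moves. -/
inductive LocalMove : List Piece → List Piece → Prop
  /-- Two pieces side by side: their heights can be exchanged. The second piece is to the right of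
  the first one, with `d` vertical strands between them. -/
  | exchange (i d : ℕ) (x y : Kind) :
      LocalMove [⟨i, x⟩, ⟨i + x.outputs + d, y⟩] [⟨i + x.inputs + d, y⟩, ⟨i, x⟩]
  /-- A minimum and a neighbouring maximum cancel (two mirror images). -/
  | zigzagRight (i : ℕ) (b : Bool) : LocalMove [⟨i + 1, .cup b⟩, ⟨i, .cap⟩] []
  | zigzagLeft (i : ℕ) (b : Bool) : LocalMove [⟨i, .cup b⟩, ⟨i + 1, .cap⟩] []
  /-- A strand passes from the right-hand leg to the left-hand leg of a minimum or a maximum,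
  staying below it, or staying above it. -/
  | slideCup (i : ℕ) (b ε : Bool) :
      LocalMove [⟨i, .cup b⟩, ⟨i + 1, .cross ε⟩] [⟨i + 1, .cup b⟩, ⟨i, .cross (!ε)⟩]
  | slideCap (i : ℕ) (ε : Bool) :
      LocalMove [⟨i + 1, .cross ε⟩, ⟨i, .cap⟩] [⟨i, .cross (!ε)⟩, ⟨i + 1, .cap⟩]
  /-- The first Reidemeister move (curl to the right and curl to the left of the strand). -/
  | reidemeisterOneRight (i : ℕ) (b ε : Bool) :
      LocalMove [⟨i + 1, .cup b⟩, ⟨i, .cross ε⟩, ⟨i + 1, .cap⟩] []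
  | reidemeisterOneLeft (i : ℕ) (b ε : Bool) :
      LocalMove [⟨i, .cup b⟩, ⟨i + 1, .cross ε⟩, ⟨i, .cap⟩] []
  /-- The second Reidemeister move. -/
  | reidemeisterTwo (i : ℕ) (ε : Bool) :
      LocalMove [⟨i, .cross ε⟩, ⟨i, .cross (!ε)⟩] []
  /-- The third Reidemeister move. -/
  | reidemeisterThree (i : ℕ) (ε : Bool) :
      LocalMove [⟨i, .cross ε⟩, ⟨i + 1, .cross ε⟩, ⟨i, .cross ε⟩]
        [⟨i + 1, .cross ε⟩, ⟨i, .cross ε⟩, ⟨i + 1, .cross ε⟩]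

/-- Two oriented link diagrams that are identical except for one local move. -/
def LinkDiagram.Move (D E : LinkDiagram) : Prop :=
  ∃ u m m' v : List Piece,
    LocalMove m m' ∧ D.word = u ++ m ++ v ∧ E.word = u ++ m' ++ v

/-- Oriented links up to ambient isotopy: oriented link diagrams modulo the equivalence relation
generated by the local moves. -/
def OrientedLink : Type := Quot LinkDiagram.Move

/-- The oriented link represented by an oriented link diagram. -/
def LinkDiagram.link (D : LinkDiagram) : OrientedLink := Quot.mk _ D

/-- The trivial knot: one minimum followed by one maximum. -/
def trivialKnot : LinkDiagram where
  word := [⟨0, .cup true⟩, ⟨0, .cap⟩]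
  closed := by decide
  nonempty := by simp

/-- An oriented link diagram with a marked place at which two neighbouring strands (number `pos` and
number `pos + 1`) run parallel in the same direction. The diagram is cut at this height into a lower
part `bottom` and an upper part `top`, and `strands` is the list of strand directions there. -/
structure ParallelSite : Type where
  bottom : List Piece
  top : List Piece
  strands : List Bool
  pos : ℕ
  dir : Bool
  run_bottom : run bottom [] = some strands
  run_top : run top strands = some []
  left_dir : strands[pos]? = some dir
  right_dir : strands[pos + 1]? = some dir

theorem run_append (u v : List Piece) (s : List Bool) :
    run (u ++ v) s = (run u s).bind (run v) := by
  induction u generalizing s with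
  | nil => simp [run]
  | cons p u ih =>
    simp only [List.cons_append, run]
    cases p.act s with
    | none => rfl
    | some t => simp [ih]

theorem run_crossings (i : ℕ) (d : Bool) (s : List Bool) (h0 : s[i]? = some d)
    (h1 : s[i + 1]? = some d) (c : List Bool) :
    run (c.map fun ε => (⟨i, .cross ε⟩ : Piece)) s = some s := by
  have hs : s = s.take i ++ d :: d :: s.drop (i + 2) := by
    obtain ⟨hi0, e0⟩ := List.getElem?_eq_some_iff.1 h0
    obtain ⟨hi1, e1⟩ := List.getElem?_eq_some_iff.1 h1
    conv_lhs => rw [← List.take_append_drop i s, List.drop_eq_getElem_cons hi0, e0,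
      List.drop_eq_getElem_cons hi1, e1]
  have hd : s.drop i = d :: d :: s.drop (i + 2) := by
    obtain ⟨hi0, e0⟩ := List.getElem?_eq_some_iff.1 h0
    obtain ⟨hi1, e1⟩ := List.getElem?_eq_some_iff.1 h1
    rw [List.drop_eq_getElem_cons hi0, e0, List.drop_eq_getElem_cons hi1, e1]
  have hl : i ≤ s.length := by
    obtain ⟨hi0, -⟩ := List.getElem?_eq_some_iff.1 h0
    exact hi0.le
  induction c with
  | nil => rfl
  | cons ε c ih =>
    have : (⟨i, .cross ε⟩ : Piece).act s = some s := by
      simp only [Piece.act, hl, if_true, hd, Kind.act, Option.map_some]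
      rw [← hs]
    simp only [List.map_cons, run, this, Option.bind_some]
    exact ih

/-- The diagram obtained from the marked diagram by inserting at the marked place a stack of
crossings of the two marked parallel strands, one for each entry of `c`. As the two strands have the
same direction, the entry `true` gives a positive crossing and `false` a negative crossing. -/
def ParallelSite.insert (S : ParallelSite) (c : List Bool) : LinkDiagram where
  word := S.bottom ++ (c.map fun ε => (⟨S.pos, .cross ε⟩ : Piece)) ++ S.top
  closed := by
    simp [run_append, S.run_bottom, S.run_top,
      run_crossings S.pos S.dir S.strands S.left_dir S.right_dir]
  nonempty := by
    intro h
    have hb : S.bottom = [] := by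
      simp only [List.append_eq_nil_iff] at h
      exact h.1.1
    have hr := S.run_bottom
    have hl := S.left_dir
    rw [hb] at hr
    simp only [run, Option.some.injEq] at hr
    rw [← hr] at hl
    simp at hl

/-- The link `L` represented by the marked diagram itself. -/
def ParallelSite.base (S : ParallelSite) : OrientedLink := (S.insert []).link

/-- The link `t_k(L)`: `k` positive half twists of the two marked parallel strands are inserted. -/
def ParallelSite.twist (S : ParallelSite) (k : ℕ) : OrientedLink :=
  (S.insert (List.replicate k true)).link

noncomputable section

/-- The ring `ℤ[a, a⁻¹][z, z⁻¹]`. -/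
abbrev LaurentAZ : Type := LaurentPolynomial (LaurentPolynomial ℤ)

/-- The element `a ^ n`. -/
def aPow (n : ℤ) : LaurentAZ := LaurentPolynomial.C (LaurentPolynomial.T n)

/-- The variable `z`. -/
def zVar : LaurentAZ := LaurentPolynomial.T 1

/-- `P` is a Jones–Conway (Homfly) polynomial: an invariant of oriented links with
`P_{T₁} = 1` and `a P_{L₊} + a⁻¹ P_{L₋} = z P_{L₀}`, where `L₊`, `L₋`, `L₀` have diagrams that are
identical except at one place, where they have a positive crossing, a negative crossing, and its
smoothing. -/
structure IsJonesConway (P : OrientedLink → LaurentAZ) : Prop where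
  trivial_knot : P trivialKnot.link = 1
  skein : ∀ S : ParallelSite,
    aPow 1 * P (S.insert [true]).link + aPow (-1) * P (S.insert [false]).link
      = zVar * P (S.insert []).link

/-- The polynomials `v₁^{(k)}(z)`, as rescaled Chebyshev polynomials of the second kind: `v₁ (-1) = -1`,
`v₁ 0 = 0`, `v₁ 1 = 1` and `v₁ (k + 2) = z v₁ (k + 1) - v₁ k`. -/
def v₁ (k : ℤ) : Polynomial ℤ := Polynomial.Chebyshev.S ℤ (k - 1)

end

end TkMoves

namespace TkMoves

/-! Apply the skein relation to the topmost of `k + 2` positive half twists. Made negative, that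
crossing cancels the one below it, leaving `k` twists; smoothed, it leaves `k + 1`. This is
`IsJonesConway.twist_add_two`. Multiplied by `a ^ (k + 1)`, it says that `x k = a ^ k * P (t_k L)`
satisfies `x (k + 2) = z * x (k + 1) - x k`, the recurrence defining `v₁`. Both sides of the formula
thus solve one second-order recurrence and agree at `k = 0, 1`. The closed form follows in the same
way, since `p ^ k` and `p ^ (-k)` solve the recurrence for `z = p + p⁻¹`. -/

theorem v₁_neg_one : v₁ (-1) = -1 := by
  simp [v₁, show (-1 - 1 : ℤ) = -2 by norm_num, Polynomial.Chebyshev.S_neg_two]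

theorem v₁_zero : v₁ 0 = 0 := by
  simp [v₁, Polynomial.Chebyshev.S_neg_one]

theorem v₁_one : v₁ 1 = 1 := by
  simp [v₁, Polynomial.Chebyshev.S_zero]

theorem v₁_add_two (k : ℤ) : v₁ (k + 2) = Polynomial.X * v₁ (k + 1) - v₁ k := by
  have h := Polynomial.Chebyshev.S_add_two ℤ (k - 1)
  rw [show k - 1 + 2 = k + 2 - 1 by ring, show k - 1 + 1 = k + 1 - 1 by ring] at h
  exact h

theorem aPow_add (m n : ℤ) : aPow (m + n) = aPow m * aPow n := by
  rw [aPow, LaurentPolynomial.T_add, map_mul]; rfl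

theorem aPow_zero : aPow 0 = 1 := by
  simp [aPow]

/-- The marked diagram obtained by inserting crossings, with the marked place above them. -/
def ParallelSite.extend (S : ParallelSite) (c : List Bool) : ParallelSite where
  bottom := S.bottom ++ c.map fun ε => (⟨S.pos, .cross ε⟩ : Piece)
  top := S.top
  strands := S.strands
  pos := S.pos
  dir := S.dir
  run_bottom := by
    simp [run_append, S.run_bottom,
      run_crossings S.pos S.dir S.strands S.left_dir S.right_dir]
  run_top := S.run_top
  left_dir := S.left_dir
  right_dir := S.right_dir

theorem ParallelSite.insert_extend (S : ParallelSite) (c d : List Bool) :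
    (S.extend c).insert d = S.insert (c ++ d) := by
  simp [insert, extend]

/-- Opposite neighbouring half twists cancel, by the second Reidemeister move. -/
theorem ParallelSite.link_insert_cancel (S : ParallelSite) (c d : List Bool) (ε : Bool) :
    (S.insert (c ++ ε :: (!ε) :: d)).link = (S.insert (c ++ d)).link := by
  refine Quot.sound ⟨S.bottom ++ c.map fun ε => (⟨S.pos, .cross ε⟩ : Piece), _, _,
    (d.map fun ε => (⟨S.pos, .cross ε⟩ : Piece)) ++ S.top,
    LocalMove.reidemeisterTwo S.pos ε, ?_, ?_⟩ <;> simp [insert]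

theorem IsJonesConway.twist_add_two {P : OrientedLink → LaurentAZ} (hP : IsJonesConway P)
    (S : ParallelSite) (k : ℕ) :
    aPow 1 * P (S.twist (k + 2)) + aPow (-1) * P (S.twist k) = zVar * P (S.twist (k + 1)) := by
  -- The marked place sits above `k + 1` positive twists, so the three links carry these twists
  -- followed by a positive, a negative or no crossing.
  have h := hP.skein (S.extend (List.replicate (k + 1) true))
  have hc := S.link_insert_cancel (List.replicate k true) [] true
  simp only [S.insert_extend, List.append_nil, ← List.replicate_succ'] at h
  rw [List.replicate_succ' (n := k), List.append_assoc] at h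
  simp only [List.append_nil, Bool.not_true] at hc
  simp only [List.singleton_append, hc, ← List.replicate_succ'] at h
  exact h

theorem IsJonesConway.aPow_mul_twist {P : OrientedLink → LaurentAZ} (hP : IsJonesConway P)
    (S : ParallelSite) (k : ℕ) :
    aPow k * P (S.twist k)
      = aPow 1 * Polynomial.aeval zVar (v₁ k) * P (S.twist 1)
        - Polynomial.aeval zVar (v₁ ((k : ℤ) - 1)) * P S.base := by
  induction k using Nat.twoStepInduction with
  | zero =>
    simp only [Nat.cast_zero, zero_sub, v₁_zero, v₁_neg_one, aPow_zero, ParallelSite.twist,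
      ParallelSite.base, List.replicate_zero, map_zero, map_neg, map_one]
    ring
  | one => simp [v₁_zero, v₁_one]
  | more k ih₀ ih₁ =>
    have h := hP.twist_add_two S k
    -- The outer powers are written through `a ^ (k + 1)`, the factor by which the skein recurrence
    -- is multiplied.
    have h₂ : aPow ((k + 2 : ℕ) : ℤ) = aPow ((k + 1 : ℕ) : ℤ) * aPow 1 := by
      rw [← aPow_add]; congr 1
    have h₀ : aPow (k : ℤ) = aPow ((k + 1 : ℕ) : ℤ) * aPow (-1) := by
      rw [← aPow_add]; congr 1; push_cast; ring
    have v₂ : v₁ ((k + 2 : ℕ) : ℤ) = Polynomial.X * v₁ ((k + 1 : ℕ) : ℤ) - v₁ k := by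
      simpa using v₁_add_two k
    have w₂ : v₁ (((k + 2 : ℕ) : ℤ) - 1)
        = Polynomial.X * v₁ (((k + 1 : ℕ) : ℤ) - 1) - v₁ ((k : ℤ) - 1) := by
      have h := v₁_add_two ((k : ℤ) - 1)
      rw [show (k : ℤ) - 1 + 2 = ((k + 2 : ℕ) : ℤ) - 1 by push_cast; ring,
        show (k : ℤ) - 1 + 1 = ((k + 1 : ℕ) : ℤ) - 1 by push_cast; ring] at h
      exact h
    rw [h₀] at ih₀
    rw [h₂, v₂, w₂]
    simp only [map_sub, map_mul, Polynomial.aeval_X]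
    linear_combination aPow ((k + 1 : ℕ) : ℤ) * h + zVar * ih₁ - ih₀

/-- The index is shifted by one so that induction over `ℕ` starts at `v₁ (-1)`. -/
theorem aeval_v₁_add_inv {K : Type*} [Field K] {p : K} (hp : p ≠ 0) (hp2 : p ^ 2 ≠ 1) (k : ℕ) :
    Polynomial.aeval (p + p⁻¹) (v₁ ((k : ℤ) - 1))
      = (p ^ ((k : ℤ) - 1) - p ^ (-((k : ℤ) - 1))) / (p - p⁻¹) := by
  -- If `p = p⁻¹`, then `p ^ 2 = p * p⁻¹ = 1`.
  have hd : p - p⁻¹ ≠ 0 := by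
    intro h
    apply hp2
    rw [sq]
    nth_rewrite 2 [sub_eq_zero.1 h]
    exact mul_inv_cancel₀ hp
  induction k using Nat.twoStepInduction with
  | zero =>
    rw [eq_div_iff hd]
    simp [v₁_neg_one]
  | one => simp [v₁_zero]
  | more k ih₀ ih₁ =>
    have h := v₁_add_two ((k : ℤ) - 1)
    rw [show (k : ℤ) - 1 + 2 = ((k + 2 : ℕ) : ℤ) - 1 by push_cast; ring,
      show (k : ℤ) - 1 + 1 = ((k + 1 : ℕ) : ℤ) - 1 by push_cast; ring] at h
    rw [h]
    simp only [map_sub, map_mul, Polynomial.aeval_X, ih₀, ih₁]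
    rw [mul_div_assoc', ← sub_div]
    congr 1
    rw [show ((k + 2 : ℕ) : ℤ) - 1 = (k : ℤ) + 1 by push_cast; ring,
      show ((k + 1 : ℕ) : ℤ) - 1 = (k : ℤ) by push_cast; ring]
    -- Every power is reduced to `p ^ k` and `p`, which leaves a rational identity.
    simp only [neg_sub, neg_add, zpow_add₀ hp, zpow_sub₀ hp, zpow_neg, zpow_one]
    field_simp
    ring

end TkMoves

theorem theorem1p1 :
    (∀ P : TkMoves.OrientedLink → TkMoves.LaurentAZ, TkMoves.IsJonesConway P →
      ∀ (S : TkMoves.ParallelSite) (k : ℕ),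
        TkMoves.aPow k * P (S.twist k)
          = TkMoves.aPow 1 * Polynomial.aeval TkMoves.zVar (TkMoves.v₁ k) * P (S.twist 1)
            - Polynomial.aeval TkMoves.zVar (TkMoves.v₁ ((k : ℤ) - 1)) * P S.base) ∧
    (TkMoves.v₁ (-1) = -1 ∧ TkMoves.v₁ 0 = 0 ∧ TkMoves.v₁ 1 = 1 ∧
      ∀ k : ℤ, -1 ≤ k →
        TkMoves.v₁ (k + 2) = Polynomial.X * TkMoves.v₁ (k + 1) - TkMoves.v₁ k) ∧
    (∀ (K : Type*) [Field K] (p : K), p ≠ 0 → p ^ 2 ≠ 1 → ∀ k : ℤ, -1 ≤ k →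
      Polynomial.aeval (p + p⁻¹) (TkMoves.v₁ k) = (p ^ k - p ^ (-k)) / (p - p⁻¹)) := by
  refine ⟨fun P hP S k => hP.aPow_mul_twist S k, ⟨TkMoves.v₁_neg_one, TkMoves.v₁_zero,
    TkMoves.v₁_one, fun k _ => TkMoves.v₁_add_two k⟩, fun K _ p hp hp2 k hk => ?_⟩
  obtain ⟨n, hn⟩ := Int.eq_ofNat_of_zero_le (show 0 ≤ k + 1 by linarith)
  obtain rfl : k = (n : ℤ) - 1 := by linarith
  exact TkMoves.aeval_v₁_add_inv hp hp2 n
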